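/- Let $\mathscr A$ be a complex Banach $^*$-algebra (not necessarily unital, with a complete submultiplicative norm; the involution need not be continuous), let $\mathscr M\subseteq\mathscr A$ be a left ideal (a linear subspace with $xa\in\mathscr M$ for all $x\in\mathscr A$, $a\in\mathscr M$), and let $f:\mathscr M\to\mathbb C$ be a linear functional. Suppose there is $e\in\mathscr A$ with $ea=a$ for all $a\in\mathscr M$. A continuous linear functional $g:\mathscr A\to\mathbb C$ is called a representable positive extension of $f$ if $g|_{\mathscr M}=f$, $g(x^*x)\ge 0$ for all $x\in\mathscr A$, and there are a $^*$-representation $\pi$ of $\mathscr A$ by bounded operators on a Hilbert space $H$ and a vector $\zeta\in H$ with $g(x)=\langle\pi(x)\zeta,\zeta\rangle$ for all $x\in\mathscr A$. Then the following are equivalent (inequalities $s\le t$ between complex numbers mean that $t-s$ is real and nonnegative): (i) there is a representable positive extension $f_N$ of $f$ that is minimal, in the sense that $f_N(x^*x)\le g(x^*x)$ for all $x\in\mathscr A$ and every representable positive extension $g$ of $f$; (ii) there is a constant $C\ge 0$ with $|f(a)|^2\le C\,f(a^*a)$ for all $a\in\mathscr M$; (iii) there is a constant $K\ge 0$ with $\sup\{|f(x^*a)|^2: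 x\in\mathscr A,\ \|x\|\le 1\}\le K\,f(a^*a)$ for all $a\in\mathscr M$. Furthermore, suppose that one (hence each) of these conditions holds. Let $\bar{\mathscr A}'$ be the Banach space of continuous conjugate-linear functionals on $\mathscr A$. Then for each $a\in\mathscr M$ the functional $Aa: x\mapsto f(x^*a)$ belongs to $\bar{\mathscr A}'$, and the operator $A:\mathscr M\to\bar{\mathscr A}'$, $a\mapsto Aa$, has a Krein–von Neumann extension $A_N$, that is, a smallest element among the bounded linear operators $B:\mathscr A\to\bar{\mathscr A}'$ that extend $A$ and satisfy $(Bx)(x)\ge 0$ for all $x\in\mathscr A$, where $B\le B'$ means $(Bx)(x)\le(B'x)(x)$ for all $x\in\mathscr A$. Every $f_N$ as in (i) is given by $$f_N(x)=\overline{(A_Ne)(x)}\qquad(x\in\mathscr A).$$ -/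

import Mathlib

open scoped ComplexOrder

universe u

namespace KreinExt

/-! Inequalities between complex numbers are those of `ComplexOrder`: `z ≤ w` means that `w - z` is
a nonnegative real number; in particular `0 ≤ z` says that `z` is real and nonnegative. -/

section Operators

variable {E : Type u} [NormedAddCommGroup E] [NormedSpace ℂ E]

/-- The topological antidual of `E`: continuous conjugate-linear functionals, with the
operator norm. -/
abbrev Antidual (E : Type u) [NormedAddCommGroup E] [NormedSpace ℂ E] : Type u := E →L⋆[ℂ] ℂ

/-- An everywhere defined bounded operator `B : E → Antidual E` is positive if `⟨B x, x⟩ ≥ 0`. -/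
def IsPositiveOp (B : E →L[ℂ] Antidual E) : Prop :=
  ∀ x : E, 0 ≤ B x x

/-- `B` is a bounded positive extension of the (not everywhere defined) operator `T`. -/
def IsPositiveExtension (T : E →ₗ.[ℂ] Antidual E) (B : E →L[ℂ] Antidual E) : Prop :=
  IsPositiveOp B ∧ ∀ a : T.domain, B (a : E) = T a

/-- `B` is the Krein–von Neumann extension of `T`: the smallest bounded positive extension
of `T`, for the order `B ≤ B'` iff `⟨B x, x⟩ ≤ ⟨B' x, x⟩` for all `x`. -/
def IsKreinVonNeumannExtension (T : E →ₗ.[ℂ] Antidual E) (B : E →L[ℂ] Antidual E) : Prop :=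
  IsPositiveExtension T B ∧
    ∀ B' : E →L[ℂ] Antidual E, IsPositiveExtension T B' → ∀ x : E, B x x ≤ B' x x

end Operators

section Functionals

variable {𝒜 : Type u} [NonUnitalNormedRing 𝒜] [NormedSpace ℂ 𝒜] [StarRing 𝒜]

/-- A functional on `𝒜` is representable if it is of the form `x ↦ ⟨π(x) ζ, ζ⟩` for a
`*`-representation `π` of `𝒜` by bounded operators on a Hilbert space `H` and some `ζ` in `H`
(Mathlib's inner product is linear in its second argument). -/
def IsRepresentable (g : 𝒜 →L[ℂ] ℂ) : Prop :=
  ∃ (H : Type u) (_ : NormedAddCommGroup H) (_ : InnerProductSpace ℂ H) (_ : CompleteSpace H)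
    (π : 𝒜 →⋆ₙₐ[ℂ] (H →L[ℂ] H)) (ζ : H), ∀ x : 𝒜, g x = inner ℂ ζ (π x ζ)

/-- `g` is a continuous representable positive functional on `𝒜` that extends `f`. -/
structure IsRepresentableExtension {M : Submodule ℂ 𝒜} (f : M →ₗ[ℂ] ℂ) (g : 𝒜 →L[ℂ] ℂ) :
    Prop where
  positive : ∀ x : 𝒜, 0 ≤ g (star x * x)
  representable : IsRepresentable g
  extends_f : ∀ a : M, g (a : 𝒜) = f a

/-- `g` is a minimal representable positive extension of `f`. -/
def IsMinimalRepresentableExtension {M : Submodule ℂ 𝒜} (f : M →ₗ[ℂ] ℂ) (g : 𝒜 →L[ℂ] ℂ) :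
    Prop :=
  IsRepresentableExtension f g ∧
    ∀ g' : 𝒜 →L[ℂ] ℂ, IsRepresentableExtension f g' →
      ∀ x : 𝒜, g (star x * x) ≤ g' (star x * x)

variable {M : Submodule ℂ 𝒜}

/-- There is `C ≥ 0` with `|f(a)|² ≤ C f(a* a)` for all `a ∈ M`. -/
def CyclicBound (hM : ∀ x a : 𝒜, a ∈ M → x * a ∈ M) (f : M →ₗ[ℂ] ℂ) : Prop :=
  ∃ C : ℝ, 0 ≤ C ∧ ∀ a : M,
    ((‖f a‖ ^ 2 : ℝ) : ℂ) ≤ (C : ℂ) * f ⟨star (a : 𝒜) * a, hM _ _ a.2⟩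

/-- There is `K ≥ 0` with `sup {|f(x* a)|² : ‖x‖ ≤ 1} ≤ K f(a* a)` for all `a ∈ M`. -/
def SupBound (hM : ∀ x a : 𝒜, a ∈ M → x * a ∈ M) (f : M →ₗ[ℂ] ℂ) : Prop :=
  ∃ K : ℝ, 0 ≤ K ∧ ∀ a : M, ∀ x : 𝒜, ‖x‖ ≤ 1 →
    ((‖f ⟨star x * (a : 𝒜), hM _ _ a.2⟩‖ ^ 2 : ℝ) : ℂ) ≤
      (K : ℂ) * f ⟨star (a : 𝒜) * a, hM _ _ a.2⟩

variable [IsScalarTower ℂ 𝒜 𝒜] [SMulCommClass ℂ 𝒜 𝒜] [StarModule ℂ 𝒜]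

/-- The operator `A` from `𝒜` to its antidual, with domain `M`, given by `⟨A a, x⟩ = f(x* a)`,
where each `x ↦ f(x* a)` is supposed to be continuous. -/
def inducedOperator (hM : ∀ x a : 𝒜, a ∈ M → x * a ∈ M) (f : M →ₗ[ℂ] ℂ)
    (hc : ∀ a : M, Continuous fun x : 𝒜 => f ⟨star x * (a : 𝒜), hM _ _ a.2⟩) :
    𝒜 →ₗ.[ℂ] Antidual 𝒜 where
  domain := M
  toFun :=
    { toFun := fun a =>
        { toFun := fun x => f ⟨star x * (a : 𝒜), hM _ _ a.2⟩
          map_add' := fun x y => by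
            rw [← map_add]
            congr 1
            ext
            simp [add_mul]
          map_smul' := fun c x => by
            rw [← map_smul]
            congr 1
            ext
            simp [smul_mul_assoc]
          cont := hc a }
      map_add' := fun a b => by
        ext x
        change f _ = f _ + f _
        rw [← map_add]
        congr 1
        ext
        simp [mul_add]
      map_smul' := fun c a => by
        ext x
        change f _ = c • f _
        rw [← map_smul]
        congr 1
        ext
        simp [mul_smul_comm] }

end Functionals

end KreinExt

/-!
The form `(a, b) ↦ f(a* b)` on the left ideal `M` is positive as soon as (ii) holds. Left
multiplication by `x` is bounded for it: if `‖x* x‖ < 1`, then `1 - x* x = (1 - k)²` with a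
self-adjoint `k`, so `f(a* a) - f((x a)* (x a)) = f((a - k a)* (a - k a)) ≥ 0`. Completion thus
gives a `*`-representation `π` on a Hilbert space with a dense map `ι` from `M`, and (ii) says that
`f` is represented by a vector `ζ`, whence `π(a) ζ = ι a`. The functional `x ↦ ⟨π(x) ζ, ζ⟩` and the
operator `⟨A_N x, y⟩ = ⟨π(x) ζ, π(y) ζ⟩` are minimal: by Cauchy–Schwarz, any positive form that
extends the given data bounds `|⟨π(x) ζ, ι a⟩|` for all `a`, hence `‖π(x) ζ‖`. Both are continuous
because every `*`-representation of a Banach `*`-algebra is. Finally, `π(e) = 1` gives the formula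
for `f_N`.
-/

open Filter Topology
open scoped ENNReal NNReal

namespace KreinExt

section SpectralRadius

variable {B : Type*} [NormedRing B] [NormedAlgebra ℂ B] [CompleteSpace B] {a b : B}

theorem spectralRadius_mul_le_of_commute (h : Commute a b) :
    spectralRadius ℂ (a * b) ≤ spectralRadius ℂ a * spectralRadius ℂ b := by
  have gelfand := spectrum.pow_nnnorm_pow_one_div_tendsto_nhds_spectralRadius (A := B)
  have ne_top (c : B) : spectralRadius ℂ c ≠ ∞ := by
    simpa using ((spectrum.spectralRadius_le_pow_nnnorm_pow_one_div ℂ c 0).trans_lt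
      (by simp [ENNReal.mul_lt_top])).ne
  refine le_of_tendsto_of_tendsto' (gelfand (a * b)) (ENNReal.Tendsto.mul (gelfand a)
    (.inr (ne_top b)) (gelfand b) (.inr (ne_top a))) fun n => ?_
  rw [← ENNReal.mul_rpow_of_nonneg _ _ (by positivity), h.mul_pow]
  gcongr
  exact_mod_cast nnnorm_mul_le (a ^ n) (b ^ n)

omit [CompleteSpace B] in
theorem spectralRadius_inv_sub_le {z : ℂ} {u : Bˣ} (hu : (u : B) = algebraMap ℂ B z - a) :
    spectralRadius ℂ (↑u⁻¹ : B) ≤ (‖z‖₊ - spectralRadius ℂ a)⁻¹ := by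
  refine iSup₂_le fun w hw => ENNReal.le_inv_iff_le_inv.mpr ?_
  have hw0 : w ≠ 0 := spectrum.ne_zero_of_mem_of_unit hw
  rw [← spectrum.map_inv, hu, ← spectrum.singleton_sub_eq] at hw
  obtain ⟨_, rfl, y, hy, hyw : _ - y = w⁻¹⟩ := hw
  rw [tsub_le_iff_right, ← ENNReal.coe_inv (by simpa using hw0), ← nnnorm_inv, ← hyw]
  calc (‖_‖₊ : ℝ≥0∞) ≤ ‖_ - y‖₊ + ‖y‖₊ := by exact_mod_cast norm_le_norm_sub_add _ y
    _ ≤ ‖_ - y‖₊ + spectralRadius ℂ a := by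
      gcongr
      exact le_iSup₂ (f := fun (k : ℂ) (_ : k ∈ spectrum ℂ a) => (‖k‖₊ : ℝ≥0∞)) y hy

theorem spectralRadius_add_le_of_commute (h : Commute a b) :
    spectralRadius ℂ (a + b) ≤ spectralRadius ℂ a + spectralRadius ℂ b := by
  refine iSup₂_le fun z hz => ?_
  by_contra! hlt
  obtain ⟨u, hu⟩ : z ∈ resolventSet ℂ a :=
    spectrum.mem_resolventSet_of_spectralRadius_lt (le_self_add.trans_lt hlt)
  have hcomm : Commute (↑u⁻¹ : B) b := by
    refine Commute.units_inv_left ?_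
    rw [hu]
    exact .sub_left (Algebra.commutes z b) h
  have hr : spectralRadius ℂ (↑u⁻¹ * b) < 1 := calc
    spectralRadius ℂ (↑u⁻¹ * b) ≤ (‖z‖₊ - spectralRadius ℂ a)⁻¹ * spectralRadius ℂ b :=
      (spectralRadius_mul_le_of_commute hcomm).trans
        (mul_le_mul_left (spectralRadius_inv_sub_le hu) _)
    _ < 1 := by
      rw [mul_comm, ← div_eq_mul_inv]
      exact ENNReal.div_lt_of_lt_mul (by rwa [one_mul, lt_tsub_iff_left])
  have hunit : IsUnit (algebraMap ℂ B 1 - ↑u⁻¹ * b) :=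
    spectrum.mem_resolventSet_of_spectralRadius_lt (by simpa using hr)
  have hfactor : algebraMap ℂ B z - (a + b) = u * (algebraMap ℂ B 1 - ↑u⁻¹ * b) := by
    rw [map_one, mul_sub, mul_one, Units.mul_inv_cancel_left, hu]
    abel
  exact hz (spectrum.mem_resolventSet_iff.mpr (hfactor ▸ u.isUnit.mul hunit))

theorem eq_of_one_sub_sq_eq_one_sub_sq (h : Commute a b) (ha : spectralRadius ℂ a < 1)
    (hb : spectralRadius ℂ b < 1) (hab : (1 - a) ^ 2 = (1 - b) ^ 2) : a = b := by
  have hlt : spectralRadius ℂ (a + b) < 2 := by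
    rw [← one_add_one_eq_two]
    exact (spectralRadius_add_le_of_commute h).trans_lt (ENNReal.add_lt_add ha hb)
  have hunit : IsUnit (algebraMap ℂ B 2 - (a + b)) :=
    spectrum.mem_resolventSet_of_spectralRadius_lt (by simpa using hlt)
  have hmul : (a - b) * (algebraMap ℂ B 2 - (a + b)) = 0 := by
    rw [map_ofNat]
    linear_combination (norm := noncomm_ring) -hab - h.eq
  exact sub_eq_zero.mp (hunit.mul_left_eq_zero.mp hmul)

end SpectralRadius

section Unitization

variable {𝕜 : Type*} [NormedField 𝕜] {𝒜 : Type*} [NonUnitalNormedRing 𝒜] [NormedSpace 𝕜 𝒜]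
  [IsScalarTower 𝕜 𝒜 𝒜] [SMulCommClass 𝕜 𝒜 𝒜]

instance : NormOneClass (WithLp 1 (Unitization 𝕜 𝒜)) where
  norm_one := by
    rw [WithLp.unitization_norm_def]
    change ‖(1 : 𝕜)‖ + ‖(0 : 𝒜)‖ = 1
    simp

variable (𝕜) in
/-- The inclusion of a nonunital normed algebra into its unitization, normed by
`‖c + x‖ = ‖c‖ + ‖x‖`. It makes the spectral theory of unital Banach algebras available. -/
def inrL1 : 𝒜 →ₙₐ[𝕜] WithLp 1 (Unitization 𝕜 𝒜) where
  toFun x := WithLp.toLp 1 (x : Unitization 𝕜 𝒜)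
  map_zero' := congrArg (WithLp.toLp 1) (Unitization.inr_zero 𝕜)
  map_add' x y := congrArg (WithLp.toLp 1) (Unitization.inr_add 𝕜 x y)
  map_mul' x y := congrArg (WithLp.toLp 1) (Unitization.inr_mul 𝕜 x y)
  map_smul' c x := congrArg (WithLp.toLp 1) (Unitization.inr_smul 𝕜 c x)

theorem nnnorm_inrL1 (x : 𝒜) : ‖inrL1 𝕜 x‖₊ = ‖x‖₊ := WithLp.unitization_nnnorm_inr x

theorem inrL1_injective : Function.Injective (inrL1 𝕜 : 𝒜 → WithLp 1 (Unitization 𝕜 𝒜)) :=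
  WithLp.unitization_isometry_inr.injective

theorem spectrum_inrL1 (x : 𝒜) : spectrum 𝕜 (inrL1 𝕜 x) = quasispectrum 𝕜 x := by
  rw [Unitization.quasispectrum_eq_spectrum_inr' 𝕜 𝕜]
  exact AlgEquiv.spectrum_eq (WithLp.unitizationAlgEquiv 𝕜).symm (x : Unitization 𝕜 𝒜)

theorem norm_le_of_mem_quasispectrum [CompleteSpace 𝕜] [CompleteSpace 𝒜] {x : 𝒜} {z : 𝕜}
    (hz : z ∈ quasispectrum 𝕜 x) : ‖z‖ ≤ ‖x‖ := by
  rw [← spectrum_inrL1] at hz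
  exact (spectrum.norm_le_norm_of_mem hz).trans_eq (congrArg NNReal.toReal (nnnorm_inrL1 x))

theorem spectralRadius_inrL1_star [StarRing 𝕜] [NormedStarGroup 𝕜] [StarRing 𝒜]
    [StarModule 𝕜 𝒜] (x : 𝒜) :
    spectralRadius 𝕜 (inrL1 𝕜 (star x)) = spectralRadius 𝕜 (inrL1 𝕜 x) := by
  have hspec : quasispectrum 𝕜 (star x) = star (quasispectrum 𝕜 x) := by
    simp only [Unitization.quasispectrum_eq_spectrum_inr' 𝕜 𝕜, Unitization.inr_star,
      spectrum.map_star]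
  simp only [spectralRadius, spectrum_inrL1, hspec, Set.mem_star]
  exact (star_involutive (R := 𝕜)).toPerm.iSup_congr fun z => by simp

end Unitization

section SquareRoot

variable {𝒜 : Type*} [NonUnitalNormedRing 𝒜] {h : 𝒜}

theorem mapsTo_half_add_mul_self_closedBall [NormedSpace ℝ 𝒜] {r : ℝ≥0}
    (hr : ‖h‖ + r * r ≤ 2 * r) :
    Set.MapsTo (fun k => (2⁻¹ : ℝ) • (h + k * k)) (Metric.closedBall 0 r)
      (Metric.closedBall 0 r) := by
  intro k hk
  rw [mem_closedBall_zero_iff] at hk ⊢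
  calc ‖(2⁻¹ : ℝ) • (h + k * k)‖ ≤ 2⁻¹ * (‖h‖ + ‖k‖ * ‖k‖) := by
        rw [norm_smul, Real.norm_of_nonneg (by positivity)]
        gcongr
        exact (norm_add_le _ _).trans (by gcongr; exact norm_mul_le k k)
    _ ≤ 2⁻¹ * (‖h‖ + r * r) := by gcongr
    _ ≤ r := by linarith

theorem lipschitzOnWith_half_add_mul_self [NormedSpace ℝ 𝒜] {r : ℝ≥0} :
    LipschitzOnWith r (fun k => (2⁻¹ : ℝ) • (h + k * k)) (Metric.closedBall 0 r) := by
  refine lipschitzOnWith_iff_dist_le_mul.mpr fun k hk l hl => ?_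
  rw [mem_closedBall_zero_iff] at hk hl
  rw [dist_eq_norm, dist_eq_norm]
  calc ‖(2⁻¹ : ℝ) • (h + k * k) - (2⁻¹ : ℝ) • (h + l * l)‖
      = 2⁻¹ * ‖k * (k - l) + (k - l) * l‖ := by
        rw [← smul_sub, norm_smul, Real.norm_of_nonneg (by positivity)]
        congr 2
        noncomm_ring
    _ ≤ 2⁻¹ * (‖k‖ * ‖k - l‖ + ‖k - l‖ * ‖l‖) := by
        gcongr
        exact (norm_add_le _ _).trans (add_le_add (norm_mul_le _ _) (norm_mul_le _ _))
    _ ≤ 2⁻¹ * (r * ‖k - l‖ + ‖k - l‖ * r) := by gcongr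
    _ = r * ‖k - l‖ := by ring

/- In the unitization `k = 1 - √(1 - h)`: the equation says that `(1 - k)² = 1 - h`. -/
theorem exists_add_self_eq_add_mul_self [CompleteSpace 𝒜] [NormedSpace ℝ 𝒜] [IsScalarTower ℝ 𝒜 𝒜]
    [SMulCommClass ℝ 𝒜 𝒜] (hh : ‖h‖ < 1) :
    ∃ k ∈ Set.centralizer (Set.centralizer {h}), ‖k‖ < 1 ∧ k + k = h + k * k := by
  obtain ⟨r, hr⟩ : ∃ r : ℝ≥0, (r : ℝ) = 1 - √(1 - ‖h‖) := ⟨⟨1 - √(1 - ‖h‖), by simp⟩, rfl⟩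
  have hr1 : r < 1 := by
    rw [← NNReal.coe_lt_one, hr]
    simpa using hh
  have hhr : ‖h‖ + r * r = 2 * r := by
    rw [hr]
    linear_combination Real.sq_sqrt (x := 1 - ‖h‖) (by linarith)
  let C := NonUnitalSubalgebra.centralizer ℝ (Set.centralizer {h})
  let s : Set 𝒜 := Metric.closedBall 0 r ∩ C
  have hs : IsComplete s :=
    (Metric.isClosed_closedBall.inter (Set.isClosed_centralizer _)).isComplete
  have hmaps : Set.MapsTo (fun k => (2⁻¹ : ℝ) • (h + k * k)) s s := fun k ⟨hk, hkC⟩ =>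
    ⟨mapsTo_half_add_mul_self_closedBall hhr.le hk,
      C.smul_mem _ (C.add_mem (Set.subset_centralizer_centralizer rfl) (C.mul_mem hkC hkC))⟩
  have hcontr : ContractingWith r (hmaps.restrict _ s s) :=
    ⟨hr1, (lipschitzOnWith_half_add_mul_self.mono Set.inter_subset_left).mapsToRestrict hmaps⟩
  obtain ⟨k, ⟨hk, hkC⟩, hfix, -⟩ := hcontr.exists_fixedPoint' hs hmaps
    (⟨by simp, C.zero_mem⟩ : 0 ∈ s) (edist_ne_top _ _)
  refine ⟨k, hkC, (mem_closedBall_zero_iff.mp hk).trans_lt hr1, ?_⟩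
  rw [← two_smul ℝ k]
  exact ((inv_smul_eq_iff₀ two_ne_zero).mp hfix).symm

/- The involution need not be continuous, so that `k = k*` cannot be inherited from the iteration
that yields `k`; but `1 - k` and `1 - k*` are commuting square roots of `1 - h`, both with spectrum
in the right half-plane, and such a root is unique. -/
theorem exists_isSelfAdjoint_add_self_eq_add_mul_self [CompleteSpace 𝒜] [NormedSpace ℂ 𝒜]
    [IsScalarTower ℂ 𝒜 𝒜] [SMulCommClass ℂ 𝒜 𝒜] [StarRing 𝒜] [StarModule ℂ 𝒜]
    (hsa : IsSelfAdjoint h) (hh : ‖h‖ < 1) :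
    ∃ k : 𝒜, IsSelfAdjoint k ∧ k + k = h + k * k := by
  obtain ⟨k, hkC, hk, hkk⟩ := exists_add_self_eq_add_mul_self hh
  have hkk_star : star k + star k = h + star k * star k := by
    simpa [hsa.star_eq] using congrArg star hkk
  have hcomm : Commute k (star k) := by
    have hkh : h * k = k * h := hkC h (by simp [Set.mem_centralizer_iff])
    refine (hkC (star k) ?_).symm
    simpa [Set.mem_centralizer_iff, hsa.star_eq] using (congrArg star hkh).symm
  have hsq {l : 𝒜} (hl : l + l = h + l * l) : (1 - inrL1 ℂ l) ^ 2 = 1 - inrL1 ℂ h := by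
    have himage := congrArg (inrL1 ℂ) hl
    simp only [map_add, map_mul] at himage
    linear_combination (norm := noncomm_ring) -himage
  have hr : spectralRadius ℂ (inrL1 ℂ k) < 1 :=
    (spectrum.spectralRadius_le_nnnorm _).trans_lt (by rw [nnnorm_inrL1]; exact_mod_cast hk)
  have hr_star : spectralRadius ℂ (inrL1 ℂ (star k)) < 1 := by rwa [spectralRadius_inrL1_star]
  have hk_eq : inrL1 ℂ k = inrL1 ℂ (star k) := eq_of_one_sub_sq_eq_one_sub_sq
    (hcomm.map (inrL1 ℂ)) hr hr_star ((hsq hkk).trans (hsq hkk_star).symm)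
  exact ⟨k, (inrL1_injective hk_eq).symm, hkk⟩

end SquareRoot

section AutomaticContinuity

variable {𝒜 : Type*} [NonUnitalNormedRing 𝒜] [CompleteSpace 𝒜] [NormedSpace ℂ 𝒜]
  [IsScalarTower ℂ 𝒜 𝒜] [SMulCommClass ℂ 𝒜 𝒜] {B : Type*} [NonUnitalCStarAlgebra B]

theorem norm_map_le_of_isStarNormal (π : 𝒜 →ₙₐ[ℂ] B) (x : 𝒜) [IsStarNormal (π x)] :
    ‖π x‖ ≤ ‖x‖ := by
  obtain ⟨⟨z, hz, hzx : ‖z‖ = ‖π x‖⟩, -⟩ :=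
    NonUnitalIsometricContinuousFunctionalCalculus.isGreatest_norm_quasispectrum (𝕜 := ℂ) (π x)
  exact hzx ▸ norm_le_of_mem_quasispectrum (NonUnitalAlgHom.quasispectrum_apply_subset π x hz)

theorem norm_map_sq_le (π : 𝒜 →ₙₐ[ℂ] B) {x y : 𝒜} (h : π y = star (π x)) :
    ‖π x‖ ^ 2 ≤ ‖y‖ * ‖x‖ := by
  have hyx : π (y * x) = star (π x) * π x := by rw [map_mul, h]
  have : IsStarNormal (π (y * x)) := hyx ▸ (IsSelfAdjoint.star_mul_self _).isStarNormal
  calc ‖π x‖ ^ 2 = ‖π (y * x)‖ := by rw [hyx, CStarRing.norm_star_mul_self, sq]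
    _ ≤ ‖y * x‖ := norm_map_le_of_isStarNormal π (y * x)
    _ ≤ ‖y‖ * ‖x‖ := norm_mul_le y x

variable [StarRing 𝒜] (π : 𝒜 →⋆ₙₐ[ℂ] B)

theorem tendsto_map_of_map_eq_star {α : Type*} {l : Filter α} {u v : α → 𝒜} {x y : 𝒜}
    (hu : Tendsto u l (𝓝 x)) (hv : Tendsto v l (𝓝 y)) (huv : ∀ i, π (v i) = star (π (u i))) :
    Tendsto (fun i => π (u i)) l (𝓝 (π x)) := by
  rw [tendsto_iff_norm_sub_tendsto_zero]
  have hsq : Tendsto (fun i => ‖π (u i - x)‖ ^ 2) l (𝓝 0) := by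
    have hadj (i : α) : π (v i - star x) = star (π (u i - x)) := by simp [huv, map_star]
    refine squeeze_zero (fun i => by positivity)
      (fun i => norm_map_sq_le (π : 𝒜 →ₙₐ[ℂ] B) (hadj i)) ?_
    simpa using (hv.sub_const (star x)).norm.mul (hu.sub_const x).norm
  simpa using hsq.sqrt

/-- The pairs `(x, y)` such that `π y` is the adjoint of `π x`. Unlike the graph of the involution,
it is closed even if the involution is not continuous. -/
def adjointPairs : Submodule ℝ (𝒜 × 𝒜) where
  carrier := {p | π p.2 = star (π p.1)}
  zero_mem' := by simp
  add_mem' {p q} (hp : π p.2 = _) (hq : π q.2 = _) := by simp [hp, hq]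
  smul_mem' c p (hp : π p.2 = _) := by simp [← Complex.coe_smul, hp]

theorem isClosed_adjointPairs : IsClosed (adjointPairs π : Set (𝒜 × 𝒜)) := by
  refine IsSeqClosed.isClosed fun u p (hu : ∀ n, π (u n).2 = star (π (u n).1)) hp => ?_
  have hfst : Tendsto (fun n => (u n).1) atTop (𝓝 p.1) := hp.fst_nhds
  have hsnd : Tendsto (fun n => (u n).2) atTop (𝓝 p.2) := hp.snd_nhds
  have hπfst := tendsto_map_of_map_eq_star π hfst hsnd hu
  have hπsnd := tendsto_map_of_map_eq_star π hsnd hfst fun n => by rw [hu, star_star]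
  exact tendsto_nhds_unique hπsnd (by simpa only [hu] using hπfst.star)

theorem continuous_of_nonUnitalStarAlgHom : Continuous π := by
  have : CompleteSpace (adjointPairs π) := (isClosed_adjointPairs π).completeSpace_coe
  let T : adjointPairs π →L[ℝ] 𝒜 := (ContinuousLinearMap.fst ℝ 𝒜 𝒜).comp (adjointPairs π).subtypeL
  have hT : Function.Surjective T := fun x => ⟨⟨(x, star x), map_star π x⟩, rfl⟩
  refine (T.isQuotientMap hT).continuous_iff.mpr (continuous_iff_continuousAt.mpr fun p => ?_)
  exact tendsto_map_of_map_eq_star π T.continuous.continuousAt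
    (continuous_snd.comp continuous_subtype_val).continuousAt fun q => q.2

end AutomaticContinuity

section SesquilinearForms

variable {V : Type*} [AddCommGroup V] [Module ℂ V] {S T : V →ₗ⋆[ℂ] V →ₗ[ℂ] ℂ}

theorem sesqForm_ext_of_apply_self (h : ∀ v, S v v = T v v) : S = T := by
  ext u v
  have h_add := h (u + v)
  have h_add_I := h (u + Complex.I • v)
  simp only [map_add, map_smul, LinearMap.map_smulₛₗ, LinearMap.add_apply, LinearMap.smul_apply,
    smul_eq_mul, Complex.conj_I, h u, h v] at h_add h_add_I
  linear_combination (1 / 2 : ℂ) * h_add - Complex.I / 2 * h_add_I +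
    (S u v / 2 - T u v / 2 + T v u / 2 - S v u / 2) * Complex.I_mul_I

theorem isSymm_of_isNonneg (hS : S.IsNonneg) : S.IsSymm := by
  have him (v : V) : (S v v).im = 0 := (Complex.nonneg_iff.mp (hS.nonneg v)).2.symm
  refine ⟨fun u v => ?_⟩
  have h_add := him (u + v)
  have h_add_I := him (u + Complex.I • v)
  simp only [map_add, map_smul, LinearMap.map_smulₛₗ, LinearMap.add_apply, LinearMap.smul_apply,
    smul_eq_mul, Complex.conj_I, Complex.add_im, Complex.add_re, Complex.mul_im, Complex.mul_re,
    Complex.neg_im, Complex.neg_re, Complex.I_re, Complex.I_im, him u, him v] at h_add h_add_I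
  apply Complex.ext <;> simp only [Complex.conj_re, Complex.conj_im] <;> linarith

/-- A positive sesquilinear form, regarded as a semi-inner product. -/
abbrev preInnerProductCore (hS : S.IsNonneg) : PreInnerProductSpace.Core ℂ V where
  inner u v := S u v
  conj_inner_symm u v := (isSymm_of_isNonneg hS).eq v u
  re_inner_nonneg v := (Complex.nonneg_iff.mp (hS.nonneg v)).1
  add_left := by simp
  smul_left := by simp

theorem norm_sesqForm_le (hS : S.IsNonneg) (u v : V) :
    ‖S u v‖ ≤ √(S u u).re * √(S v v).re :=
  letI := preInnerProductCore hS
  InnerProductSpace.Core.norm_inner_le_norm u v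

theorem exists_denseRange_inner_eq {V : Type u} [AddCommGroup V] [Module ℂ V]
    {S : V →ₗ⋆[ℂ] V →ₗ[ℂ] ℂ} (hS : S.IsNonneg) :
    ∃ (H : Type u) (_ : NormedAddCommGroup H) (_ : InnerProductSpace ℂ H) (_ : CompleteSpace H)
      (ι : V →ₗ[ℂ] H), DenseRange ι ∧ ∀ u v, inner ℂ (ι u) (ι v) = S u v := by
  let c := preInnerProductCore hS
  let : SeminormedAddCommGroup V := InnerProductSpace.Core.toSeminormedAddCommGroup (c := c)
  let : InnerProductSpace ℂ V := InnerProductSpace.ofCore c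
  exact ⟨UniformSpace.Completion V, inferInstance, inferInstance, inferInstance,
    (UniformSpace.Completion.toComplₗᵢ (𝕜 := ℂ) (E := V)).toLinearMap,
    UniformSpace.Completion.denseRange_coe, UniformSpace.Completion.inner_coe⟩

end SesquilinearForms

section DenseRange

theorem inner_self_eq_ofReal_norm_sq {H : Type*} [NormedAddCommGroup H] [InnerProductSpace ℂ H]
    (v : H) : inner ℂ v v = ((‖v‖ ^ 2 : ℝ) : ℂ) := by
  rw [inner_self_eq_norm_sq_to_K, Complex.ofReal_pow]
  rfl

theorem le_sqrt_mul_norm_of_sq_le_mul_inner_self {H : Type*} [NormedAddCommGroup H]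
    [InnerProductSpace ℂ H] {s C : ℝ} {v : H} (h : ((s ^ 2 : ℝ) : ℂ) ≤ C * inner ℂ v v) :
    s ≤ √C * ‖v‖ := by
  rw [inner_self_eq_ofReal_norm_sq, ← Complex.ofReal_mul, Complex.real_le_real] at h
  rw [← Real.sqrt_sq (norm_nonneg v), ← Real.sqrt_mul' C (sq_nonneg _)]
  exact Real.le_sqrt_of_sq_le h

variable {𝕜 : Type*} [RCLike 𝕜] {V : Type*} [AddCommGroup V] [Module 𝕜 V]
  {H : Type*} [NormedAddCommGroup H] [InnerProductSpace 𝕜 H]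

theorem norm_le_of_forall_norm_inner_le {α : Type*} {ι : α → H} (hι : DenseRange ι) {v : H} {t : ℝ}
    (ht : 0 ≤ t) (h : ∀ b, ‖inner 𝕜 v (ι b)‖ ≤ t * ‖ι b‖) : ‖v‖ ≤ t := by
  rw [← innerSL_apply_norm 𝕜 v]
  exact ContinuousLinearMap.opNorm_le_bound _ ht fun w =>
    hι.induction_on (p := fun w => ‖inner 𝕜 v w‖ ≤ t * ‖w‖) w
      (isClosed_le (by fun_prop) (by fun_prop)) h

variable [CompleteSpace H] {ι : V →ₗ[𝕜] H}

theorem exists_forall_inner_eq (hι : DenseRange ι) {f : V →ₗ[𝕜] 𝕜}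
    (hf : ∃ c, ∀ v, ‖f v‖ ≤ c * ‖ι v‖) : ∃ ζ : H, ∀ v, inner 𝕜 ζ (ι v) = f v :=
  ⟨(InnerProductSpace.toDual 𝕜 H).symm (f.extendOfNorm ι), fun v => by
    rw [InnerProductSpace.toDual_symm_apply, LinearMap.extendOfNorm_eq hι hf]⟩

theorem exists_nonUnitalStarAlgHom_apply_eq {𝒜 : Type*} [NonUnitalNonAssocSemiring 𝒜] [Module 𝕜 𝒜]
    [Star 𝒜] (hι : DenseRange ι) (L : 𝒜 →ₙₐ[𝕜] Module.End 𝕜 V)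
    (hL : ∀ x, ∃ c, ∀ v, ‖ι (L x v)‖ ≤ c * ‖ι v‖)
    (hL_star : ∀ x u v, inner 𝕜 (ι (L (star x) u)) (ι v) = inner 𝕜 (ι u) (ι (L x v))) :
    ∃ π : 𝒜 →⋆ₙₐ[𝕜] (H →L[𝕜] H), ∀ x v, π x (ι v) = ι (L x v) := by
  let P (x : 𝒜) : H →L[𝕜] H := (ι ∘ₗ L x).extendOfNorm ι
  have hP (x : 𝒜) (v : V) : P x (ι v) = ι (L x v) := LinearMap.extendOfNorm_eq hι (hL x) v
  have hext {T U : H →L[𝕜] H} (h : ∀ v, T (ι v) = U (ι v)) : T = U :=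
    DFunLike.coe_injective (hι.equalizer T.continuous U.continuous (funext h))
  have hadj (x : 𝒜) : P (star x) = star (P x) := by
    refine (ContinuousLinearMap.eq_adjoint_iff _ _).mpr fun u v => ?_
    refine hι.induction_on₂ (p := fun u v => inner 𝕜 (P (star x) u) v = inner 𝕜 u (P x v))
      (isClosed_eq (by fun_prop) (by fun_prop)) (fun a b => ?_) u v
    rw [hP, hP, hL_star]
  exact ⟨{
    toFun := P
    map_smul' c x := hext fun v => by simp [hP]
    map_zero' := hext fun v => by simp [hP]
    map_add' x y := hext fun v => by simp [hP]
    map_mul' x y := hext fun v => by simp [hP]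
    map_star' := hadj }, hP⟩

end DenseRange

section GNS

variable {𝒜 : Type*} [NonUnitalNormedRing 𝒜] [CompleteSpace 𝒜] [NormedSpace ℂ 𝒜]
  [IsScalarTower ℂ 𝒜 𝒜] [SMulCommClass ℂ 𝒜 𝒜] [StarRing 𝒜] [StarModule ℂ 𝒜]
  {V : Type u} [AddCommGroup V] [Module ℂ V] {S : V →ₗ⋆[ℂ] V →ₗ[ℂ] ℂ}
  {L : 𝒜 →ₙₐ[ℂ] Module.End ℂ V}

theorem sesqForm_apply_action_le (hS : S.IsNonneg)
    (hL : ∀ x u v, S (L x u) v = S u (L (star x) v)) {h : 𝒜} (hsa : IsSelfAdjoint h)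
    (hh : ‖h‖ < 1) (v : V) : S v (L h v) ≤ S v v := by
  obtain ⟨k, hk, hkh⟩ := exists_isSelfAdjoint_add_self_eq_add_mul_self hsa hh
  have hsub : S (v - L k v) (v - L k v) = S v v - S v (L h v) := by
    rw [eq_sub_of_add_eq hkh.symm]
    simp only [map_sub, map_add, map_mul, LinearMap.sub_apply, LinearMap.add_apply,
      Module.End.mul_apply, hL, hk.star_eq]
    ring
  exact sub_nonneg.mp (hsub ▸ hS.nonneg _)

theorem exists_sesqForm_action_le (hS : S.IsNonneg)
    (hL : ∀ x u v, S (L x u) v = S u (L (star x) v)) (x : 𝒜) :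
    ∃ c : ℝ, ∀ v, S (L x v) (L x v) ≤ c * S v v := by
  set c : ℝ := ‖star x * x‖ + 1
  have hc0 : 0 < c := by positivity
  refine ⟨c, fun v => ?_⟩
  have hnorm : ‖(c : ℂ)⁻¹ • (star x * x)‖ < 1 := by
    rw [norm_smul, norm_inv, Complex.norm_real, Real.norm_of_nonneg hc0.le, inv_mul_lt_one₀ hc0]
    exact lt_add_one _
  have hle := sesqForm_apply_action_le hS hL (h := (c : ℂ)⁻¹ • (star x * x))
    (by simp [IsSelfAdjoint]) hnorm v
  rw [map_smul, map_mul, LinearMap.smul_apply, map_smul, Module.End.mul_apply, ← hL,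
    smul_eq_mul] at hle
  rwa [← inv_mul_le_iff₀ (Complex.zero_lt_real.mpr hc0)]

theorem exists_representation (hS : S.IsNonneg)
    (hL : ∀ x u v, S (L x u) v = S u (L (star x) v)) :
    ∃ (H : Type u) (_ : NormedAddCommGroup H) (_ : InnerProductSpace ℂ H) (_ : CompleteSpace H)
      (ι : V →ₗ[ℂ] H) (π : 𝒜 →⋆ₙₐ[ℂ] (H →L[ℂ] H)), DenseRange ι ∧
      (∀ u v, inner ℂ (ι u) (ι v) = S u v) ∧ ∀ x v, π x (ι v) = ι (L x v) := by
  obtain ⟨H, _, _, _, ι, hd, hι⟩ := exists_denseRange_inner_eq hS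
  have hbound (x : 𝒜) : ∃ c, ∀ v, ‖ι (L x v)‖ ≤ c * ‖ι v‖ := by
    obtain ⟨c, hc⟩ := exists_sesqForm_action_le hS hL x
    refine ⟨√c, fun v => le_sqrt_mul_norm_of_sq_le_mul_inner_self ?_⟩
    rw [← inner_self_eq_ofReal_norm_sq, hι, hι]
    exact hc v
  obtain ⟨π, hπ⟩ := exists_nonUnitalStarAlgHom_apply_eq hd L hbound fun x u v => by
    rw [hι, hι, hL, star_star]
  exact ⟨H, _, _, _, ι, π, hd, hι, hπ⟩

end GNS

section Representations

variable {𝒜 : Type*} [NonUnitalNormedRing 𝒜] [NormedSpace ℂ 𝒜] [StarRing 𝒜]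
  {H : Type*} [NormedAddCommGroup H] [InnerProductSpace ℂ H] [CompleteSpace H]
  (π : 𝒜 →⋆ₙₐ[ℂ] (H →L[ℂ] H)) (ζ : H)

theorem inner_map_star_apply (x : 𝒜) (u v : H) :
    inner ℂ u (π (star x) v) = inner ℂ (π x u) v := by
  rw [map_star, ContinuousLinearMap.star_eq_adjoint, ContinuousLinearMap.adjoint_inner_right]

theorem inner_map_star_mul_apply (x y : 𝒜) (u v : H) :
    inner ℂ u (π (star x * y) v) = inner ℂ (π x u) (π y v) := by
  rw [map_mul, mul_apply_eq_comp, inner_map_star_apply]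

variable [CompleteSpace 𝒜] [IsScalarTower ℂ 𝒜 𝒜] [SMulCommClass ℂ 𝒜 𝒜]

/-- The orbit map `x ↦ π(x) ζ` of a vector under a representation; it is continuous because every
representation of a Banach `*`-algebra is. -/
noncomputable def orbitMap : 𝒜 →L[ℂ] H where
  toFun x := π x ζ
  map_add' := by simp
  map_smul' := by simp
  cont := (continuous_of_nonUnitalStarAlgHom π).clm_apply continuous_const

@[simp]
theorem orbitMap_apply (x : 𝒜) : orbitMap π ζ x = π x ζ := rfl

/-- The vector functional `x ↦ ⟨π(x) ζ, ζ⟩` of a representation. -/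
noncomputable def vectorFunctional : 𝒜 →L[ℂ] ℂ := (innerSL ℂ ζ).comp (orbitMap π ζ)

theorem vectorFunctional_apply (x : 𝒜) : vectorFunctional π ζ x = inner ℂ ζ (π x ζ) := rfl

theorem vectorFunctional_star_mul_self (x : 𝒜) :
    vectorFunctional π ζ (star x * x) = ((‖π x ζ‖ ^ 2 : ℝ) : ℂ) := by
  rw [vectorFunctional_apply, inner_map_star_mul_apply, inner_self_eq_ofReal_norm_sq]

end Representations

section RepresentableFunctionals

variable {𝒜 : Type u} [NonUnitalNormedRing 𝒜] [NormedSpace ℂ 𝒜] [StarRing 𝒜] {g : 𝒜 →L[ℂ] ℂ}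

theorem IsRepresentable.exists_norm_sq_le (hg : IsRepresentable g) :
    ∃ C : ℝ, 0 ≤ C ∧ ∀ x, ((‖g x‖ ^ 2 : ℝ) : ℂ) ≤ C * g (star x * x) := by
  obtain ⟨H, _, _, _, π, ζ, hπ⟩ := hg
  refine ⟨‖ζ‖ ^ 2, by positivity, fun x => ?_⟩
  rw [hπ, hπ, inner_map_star_mul_apply, inner_self_eq_ofReal_norm_sq, ← Complex.ofReal_mul,
    Complex.real_le_real, ← mul_pow]
  gcongr
  exact norm_inner_le_norm ζ (π x ζ)

theorem IsRepresentable.apply_eq_zero (hg : IsRepresentable g) {x : 𝒜}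
    (hx : g (star x * x) = 0) : g x = 0 := by
  obtain ⟨C, -, h⟩ := hg.exists_norm_sq_le
  have hgx := h x
  rw [hx, mul_zero, ← Complex.ofReal_zero, Complex.real_le_real] at hgx
  simpa using hgx.antisymm (sq_nonneg _)

variable {M : Submodule ℂ 𝒜} {f : M →ₗ[ℂ] ℂ}

theorem IsRepresentableExtension.cyclicBound (hM : ∀ x a : 𝒜, a ∈ M → x * a ∈ M)
    (hg : IsRepresentableExtension f g) : CyclicBound hM f := by
  obtain ⟨C, hC, h⟩ := hg.representable.exists_norm_sq_le
  exact ⟨C, hC, fun a => by simpa only [← hg.extends_f] using h a⟩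

variable [IsScalarTower ℂ 𝒜 𝒜] [SMulCommClass ℂ 𝒜 𝒜] [StarModule ℂ 𝒜]

/-- The sesquilinear form `(x, y) ↦ g(x* y)`. -/
noncomputable def functionalForm (g : 𝒜 →L[ℂ] ℂ) : 𝒜 →ₗ⋆[ℂ] 𝒜 →ₗ[ℂ] ℂ :=
  LinearMap.mk₂'ₛₗ (starRingEnd ℂ) (RingHom.id ℂ) (fun x y => g (star x * y))
    (by simp [add_mul]) (by simp [smul_mul_assoc]) (by simp [mul_add]) (by simp [mul_smul_comm])

theorem IsMinimalRepresentableExtension.functionalForm_eq {g' : 𝒜 →L[ℂ] ℂ}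
    (hg : IsMinimalRepresentableExtension f g) (hg' : IsMinimalRepresentableExtension f g') :
    functionalForm g = functionalForm g' :=
  sesqForm_ext_of_apply_self fun x => (hg.2 g' hg'.1 x).antisymm (hg'.2 g hg.1 x)

end RepresentableFunctionals

section PositiveOperators

variable {E : Type u} [NormedAddCommGroup E] [NormedSpace ℂ E]

/-- The sesquilinear form `(x, y) ↦ ⟨B y, x⟩`. -/
noncomputable def operatorForm (B : E →L[ℂ] Antidual E) : E →ₗ⋆[ℂ] E →ₗ[ℂ] ℂ :=
  LinearMap.mk₂'ₛₗ (starRingEnd ℂ) (RingHom.id ℂ) (fun x y => B y x)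
    (by simp) (by simp) (by simp) (by simp)

theorem IsKreinVonNeumannExtension.unique {T : E →ₗ.[ℂ] Antidual E} {B B' : E →L[ℂ] Antidual E}
    (hB : IsKreinVonNeumannExtension T B) (hB' : IsKreinVonNeumannExtension T B') : B = B' := by
  have hform : operatorForm B = operatorForm B' :=
    sesqForm_ext_of_apply_self fun x => (hB.2 B' hB'.1 x).antisymm (hB'.2 B hB.1 x)
  ext x y
  exact LinearMap.congr_fun₂ hform y x

variable {H : Type*} [NormedAddCommGroup H] [InnerProductSpace ℂ H]

/-- The positive operator `T* T` on `E`, with `⟨T* T x, y⟩ = ⟨T x, T y⟩`. -/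
noncomputable def gramOperator (T : E →L[ℂ] H) : E →L[ℂ] Antidual E :=
  (innerSL ℂ).flip.bilinearComp T T

theorem gramOperator_apply (T : E →L[ℂ] H) (x y : E) :
    gramOperator T x y = inner ℂ (T y) (T x) := rfl

theorem gramOperator_apply_self (T : E →L[ℂ] H) (x : E) :
    gramOperator T x x = ((‖T x‖ ^ 2 : ℝ) : ℂ) :=
  inner_self_eq_ofReal_norm_sq (T x)

end PositiveOperators

section LeftIdeals

variable {𝒜 : Type u} [NonUnitalNormedRing 𝒜] [NormedSpace ℂ 𝒜]
  [IsScalarTower ℂ 𝒜 𝒜] [SMulCommClass ℂ 𝒜 𝒜]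
  {M : Submodule ℂ 𝒜} (hM : ∀ x a : 𝒜, a ∈ M → x * a ∈ M)

/-- The action of `𝒜` on a left ideal by left multiplication. -/
def leftMul : 𝒜 →ₙₐ[ℂ] Module.End ℂ M where
  toFun x := (LinearMap.mulLeft ℂ x).restrict (hM x)
  map_smul' c x := LinearMap.ext fun a => Subtype.ext (smul_mul_assoc c x (a : 𝒜))
  map_zero' := LinearMap.ext fun a => Subtype.ext (zero_mul (a : 𝒜))
  map_add' x y := LinearMap.ext fun a => Subtype.ext (add_mul x y (a : 𝒜))
  map_mul' x y := LinearMap.ext fun a => Subtype.ext (mul_assoc x y (a : 𝒜))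

@[simp]
theorem coe_leftMul_apply (x : 𝒜) (a : M) : (leftMul hM x a : 𝒜) = x * a := rfl

theorem leftMul_left_unit {e : 𝒜} (he : ∀ a ∈ M, e * a = a) : leftMul hM e = 1 :=
  LinearMap.ext fun a => Subtype.ext (he a a.2)

variable [StarRing 𝒜] [StarModule ℂ 𝒜]

theorem SupBound.cyclicBound {f : M →ₗ[ℂ] ℂ} {e : 𝒜} (he : ∀ a ∈ M, e * a = a)
    (hf : SupBound hM f) : CyclicBound hM f := by
  obtain ⟨K, hK, h⟩ := hf
  set r : ℝ := ‖star e‖ + 1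
  have hr0 : 0 < r := by positivity
  refine ⟨r ^ 2 * K, by positivity, fun a => ?_⟩
  have hnorm : ‖(r : ℂ)⁻¹ • star e‖ ≤ 1 := by
    rw [norm_smul, norm_inv, Complex.norm_real, Real.norm_of_nonneg hr0.le, inv_mul_le_one₀ hr0]
    exact (lt_add_one _).le
  have hfe : f (leftMul hM (star ((r : ℂ)⁻¹ • star e)) a) = (r : ℂ)⁻¹ * f a := by
    simp [leftMul_left_unit hM he]
  have hle : ((‖(r : ℂ)⁻¹ * f a‖ ^ 2 : ℝ) : ℂ) ≤ K * f ⟨star (a : 𝒜) * a, hM _ _ a.2⟩ :=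
    hfe ▸ h a _ hnorm
  calc ((‖f a‖ ^ 2 : ℝ) : ℂ) = (r ^ 2 : ℝ) * (‖(r : ℂ)⁻¹ * f a‖ ^ 2 : ℝ) := by
        rw [norm_mul, norm_inv, Complex.norm_real, Real.norm_of_nonneg hr0.le,
          ← Complex.ofReal_mul, ← mul_pow, mul_inv_cancel_left₀ hr0.ne']
    _ ≤ (r ^ 2 : ℝ) * (K * f ⟨star (a : 𝒜) * a, hM _ _ a.2⟩) :=
      mul_le_mul_of_nonneg_left hle (Complex.zero_le_real.mpr (sq_nonneg r))
    _ = (r ^ 2 * K : ℝ) * f ⟨star (a : 𝒜) * a, hM _ _ a.2⟩ := by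
      rw [Complex.ofReal_mul, mul_assoc]

/-- The sesquilinear form `(a, b) ↦ f(a* b)` on a left ideal. -/
noncomputable def idealForm (f : M →ₗ[ℂ] ℂ) : M →ₗ⋆[ℂ] M →ₗ[ℂ] ℂ :=
  LinearMap.mk₂'ₛₗ (starRingEnd ℂ) (RingHom.id ℂ) (fun a b => f (leftMul hM (star (a : 𝒜)) b))
    (by simp) (by simp) (by simp) (by simp)

theorem idealForm_apply (f : M →ₗ[ℂ] ℂ) (a b : M) :
    idealForm hM f a b = f ⟨star (a : 𝒜) * b, hM _ _ b.2⟩ := rfl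

theorem idealForm_leftMul (f : M →ₗ[ℂ] ℂ) (x : 𝒜) (a b : M) :
    idealForm hM f (leftMul hM x a) b = idealForm hM f a (leftMul hM (star x) b) := by
  simp only [idealForm_apply, coe_leftMul_apply, star_mul, mul_assoc]

theorem CyclicBound.isNonneg_idealForm {f : M →ₗ[ℂ] ℂ} (hf : CyclicBound hM f) :
    (idealForm hM f).IsNonneg := by
  obtain ⟨C, hC, h⟩ := hf
  refine ⟨fun a => ?_⟩
  rcases hC.eq_or_lt with rfl | hC
  · have hf0 (b : M) : f b = 0 := by
      have hb : ‖f b‖ ^ 2 ≤ 0 := by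
        have hb := h b
        rwa [Complex.ofReal_zero, zero_mul, ← Complex.ofReal_zero, Complex.real_le_real] at hb
      simpa using hb.antisymm (sq_nonneg _)
    rw [idealForm_apply, hf0]
  · have hCa : 0 ≤ (C : ℂ) * idealForm hM f a a :=
      (Complex.zero_le_real.mpr (sq_nonneg _)).trans (h a)
    have := mul_nonneg (Complex.zero_le_real.mpr (inv_nonneg.mpr hC.le)) hCa
    rwa [Complex.ofReal_inv, inv_mul_cancel_left₀ (Complex.ofReal_ne_zero.mpr hC.ne')] at this

/-- A GNS representation for the functional `f` on the left ideal `M`: a `*`-representation `π` on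
`H`, a dense map `ι` from `M` that carries `f(a* b)` to the inner product and intertwines `π` with
left multiplication, and a vector `ζ` that represents `f`. -/
structure IdealGNS (f : M →ₗ[ℂ] ℂ) (H : Type*) [NormedAddCommGroup H] [InnerProductSpace ℂ H]
    [CompleteSpace H] where
  ι : M →ₗ[ℂ] H
  π : 𝒜 →⋆ₙₐ[ℂ] (H →L[ℂ] H)
  ζ : H
  dense : DenseRange ι
  inner_ι : ∀ a b, inner ℂ (ι a) (ι b) = idealForm hM f a b
  π_ι : ∀ x a, π x (ι a) = ι (leftMul hM x a)
  inner_ζ : ∀ a, inner ℂ ζ (ι a) = f a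

theorem CyclicBound.exists_idealGNS [CompleteSpace 𝒜] {f : M →ₗ[ℂ] ℂ} (hf : CyclicBound hM f) :
    ∃ (H : Type u) (_ : NormedAddCommGroup H) (_ : InnerProductSpace ℂ H) (_ : CompleteSpace H),
      Nonempty (IdealGNS hM f H) := by
  obtain ⟨H, _, _, _, ι, π, hd, hι, hπ⟩ :=
    exists_representation (hf.isNonneg_idealForm hM) (idealForm_leftMul hM f)
  have hbound : ∃ c, ∀ a, ‖f a‖ ≤ c * ‖ι a‖ := by
    obtain ⟨C, -, h⟩ := hf
    refine ⟨√C, fun a => le_sqrt_mul_norm_of_sq_le_mul_inner_self ?_⟩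
    rw [hι]
    exact h a
  obtain ⟨ζ, hζ⟩ := exists_forall_inner_eq hd hbound
  exact ⟨H, _, _, _, ⟨⟨ι, π, ζ, hd, hι, hπ, hζ⟩⟩⟩

end LeftIdeals

namespace IdealGNS

variable {𝒜 : Type u} [NonUnitalNormedRing 𝒜] [NormedSpace ℂ 𝒜]
  [IsScalarTower ℂ 𝒜 𝒜] [SMulCommClass ℂ 𝒜 𝒜] [StarRing 𝒜] [StarModule ℂ 𝒜]
  {M : Submodule ℂ 𝒜} {hM : ∀ x a : 𝒜, a ∈ M → x * a ∈ M} {f : M →ₗ[ℂ] ℂ}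
  {H : Type u} [NormedAddCommGroup H] [InnerProductSpace ℂ H] [CompleteSpace H]
  (D : IdealGNS hM f H) {e : 𝒜}

theorem inner_π_ζ_ι (x : 𝒜) (a : M) :
    inner ℂ (D.π x D.ζ) (D.ι a) = f ⟨star x * (a : 𝒜), hM _ _ a.2⟩ := by
  rw [← inner_map_star_apply, D.π_ι, D.inner_ζ]
  rfl

theorem π_coe_ζ (a : M) : D.π a D.ζ = D.ι a :=
  D.dense.eq_of_inner_left ℂ fun b => by rw [D.inner_π_ζ_ι, D.inner_ι, idealForm_apply]

theorem norm_ι_sq (a : M) :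
    ((‖D.ι a‖ ^ 2 : ℝ) : ℂ) = f ⟨star (a : 𝒜) * a, hM _ _ a.2⟩ := by
  rw [← inner_self_eq_ofReal_norm_sq, D.inner_ι, idealForm_apply]

theorem π_left_unit (he : ∀ a ∈ M, e * a = a) : D.π e = 1 :=
  DFunLike.coe_injective <| D.dense.equalizer (D.π e).continuous continuous_id <| funext fun a => by
    simp [D.π_ι, leftMul_left_unit hM he]

theorem norm_π_ζ_sq_le {S : 𝒜 →ₗ⋆[ℂ] 𝒜 →ₗ[ℂ] ℂ} (hS : S.IsNonneg)
    (hSf : ∀ (x : 𝒜) (a : M), S x a = f ⟨star x * (a : 𝒜), hM _ _ a.2⟩) (x : 𝒜) :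
    ((‖D.π x D.ζ‖ ^ 2 : ℝ) : ℂ) ≤ S x x := by
  obtain ⟨hre, him⟩ := Complex.nonneg_iff.mp (hS.nonneg x)
  have hle : ‖D.π x D.ζ‖ ≤ √(S x x).re := by
    refine norm_le_of_forall_norm_inner_le (𝕜 := ℂ) D.dense (Real.sqrt_nonneg _) fun a => ?_
    have hcs := norm_sesqForm_le hS x a
    rwa [hSf x a, hSf a a, ← D.norm_ι_sq, ← D.inner_π_ζ_ι, Complex.ofReal_re,
      Real.sqrt_sq (norm_nonneg _)] at hcs
  exact Complex.le_def.mpr ⟨(Real.le_sqrt (norm_nonneg _) hre).mp hle, him⟩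

variable [CompleteSpace 𝒜]

include D in
theorem continuous_apply_star_mul (a : M) :
    Continuous fun x : 𝒜 => f ⟨star x * (a : 𝒜), hM _ _ a.2⟩ := by
  simp_rw [← D.inner_π_ζ_ι, ← orbitMap_apply]
  fun_prop

include D in
theorem supBound : SupBound hM f := by
  refine ⟨‖orbitMap D.π D.ζ‖ ^ 2, by positivity, fun a x hx => ?_⟩
  rw [← D.norm_ι_sq, ← D.inner_π_ζ_ι, ← Complex.ofReal_mul, Complex.real_le_real, ← mul_pow]
  gcongr
  refine (norm_inner_le_norm _ _).trans ?_
  gcongr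
  exact (orbitMap D.π D.ζ).unit_le_opNorm x hx

theorem isMinimalRepresentableExtension_vectorFunctional :
    IsMinimalRepresentableExtension f (vectorFunctional D.π D.ζ) := by
  refine ⟨⟨fun x => ?_, ⟨H, _, _, _, D.π, D.ζ, fun _ => rfl⟩, fun a => ?_⟩, fun g hg x => ?_⟩
  · rw [vectorFunctional_star_mul_self]
    exact Complex.zero_le_real.mpr (sq_nonneg _)
  · rw [vectorFunctional_apply, D.π_coe_ζ, D.inner_ζ]
  · rw [vectorFunctional_star_mul_self]
    exact D.norm_π_ζ_sq_le (S := functionalForm g) ⟨hg.positive⟩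
      (fun y a => hg.extends_f ⟨star y * (a : 𝒜), hM _ _ a.2⟩) x

theorem isKreinVonNeumannExtension_gramOperator
    (hc : ∀ a : M, Continuous fun x : 𝒜 => f ⟨star x * (a : 𝒜), hM _ _ a.2⟩) :
    IsKreinVonNeumannExtension (inducedOperator hM f hc) (gramOperator (orbitMap D.π D.ζ)) := by
  refine ⟨⟨fun x => ?_, fun a => ?_⟩, fun B ⟨hB, hBf⟩ x => ?_⟩
  · rw [gramOperator_apply_self]
    exact Complex.zero_le_real.mpr (sq_nonneg _)
  · ext x
    exact (congr_arg (inner ℂ _) (D.π_coe_ζ a)).trans (D.inner_π_ζ_ι x a)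
  · rw [gramOperator_apply_self]
    exact D.norm_π_ζ_sq_le (S := operatorForm B) ⟨hB⟩ (fun y a => DFunLike.congr_fun (hBf a) y) x

theorem eq_vectorFunctional (he : ∀ a ∈ M, e * a = a) {g : 𝒜 →L[ℂ] ℂ}
    (hg : IsMinimalRepresentableExtension f g) : g = vectorFunctional D.π D.ζ := by
  have hform (x y : 𝒜) : g (star x * y) = vectorFunctional D.π D.ζ (star x * y) :=
    LinearMap.congr_fun₂
      (hg.functionalForm_eq D.isMinimalRepresentableExtension_vectorFunctional) x y
  have hge (x : 𝒜) : g (e * x) = g x := by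
    rw [← sub_eq_zero, ← map_sub]
    refine hg.1.representable.apply_eq_zero ?_
    rw [hform, vectorFunctional_star_mul_self]
    simp [D.π_left_unit he]
  ext x
  calc g x = g (star (star e) * x) := by rw [star_star, hge]
    _ = inner ℂ D.ζ (D.π e (D.π x D.ζ)) := by
      rw [hform, star_star, vectorFunctional_apply, map_mul, mul_apply_eq_comp]
    _ = vectorFunctional D.π D.ζ x := by
      rw [D.π_left_unit he, one_apply_eq_self, vectorFunctional_apply]

theorem vectorFunctional_eq_conj_gramOperator (he : ∀ a ∈ M, e * a = a) (x : 𝒜) :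
    vectorFunctional D.π D.ζ x = starRingEnd ℂ (gramOperator (orbitMap D.π D.ζ) e x) := by
  rw [gramOperator_apply, inner_conj_symm, orbitMap_apply, D.π_left_unit he]
  rfl

end IdealGNS

end KreinExt

theorem corollary5p7 {𝒜 : Type u} [NonUnitalNormedRing 𝒜] [CompleteSpace 𝒜] [NormedSpace ℂ 𝒜]
    [IsScalarTower ℂ 𝒜 𝒜] [SMulCommClass ℂ 𝒜 𝒜] [StarRing 𝒜] [StarModule ℂ 𝒜]
    (M : Submodule ℂ 𝒜) (hM : ∀ x a : 𝒜, a ∈ M → x * a ∈ M)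
    (f : M →ₗ[ℂ] ℂ) (e : 𝒜) (he : ∀ a ∈ M, e * a = a) :
    List.TFAE
      [∃ fN : 𝒜 →L[ℂ] ℂ, KreinExt.IsMinimalRepresentableExtension f fN,
       KreinExt.CyclicBound hM f,
       KreinExt.SupBound hM f] ∧
    (KreinExt.SupBound hM f →
      ∃ hc : ∀ a : M, Continuous fun x : 𝒜 => f ⟨star x * (a : 𝒜), hM _ _ a.2⟩,
        (∃ AN : 𝒜 →L[ℂ] KreinExt.Antidual 𝒜,
          KreinExt.IsKreinVonNeumannExtension (KreinExt.inducedOperator hM f hc) AN) ∧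
        ∀ (AN : 𝒜 →L[ℂ] KreinExt.Antidual 𝒜) (fN : 𝒜 →L[ℂ] ℂ),
          KreinExt.IsKreinVonNeumannExtension (KreinExt.inducedOperator hM f hc) AN →
          KreinExt.IsMinimalRepresentableExtension f fN →
          ∀ x : 𝒜, fN x = starRingEnd ℂ (AN e x)) := by
  have cyclicBound_of_supBound : KreinExt.SupBound hM f → KreinExt.CyclicBound hM f :=
    KreinExt.SupBound.cyclicBound hM he
  refine ⟨?_, fun hf => ?_⟩
  · tfae_have 1 → 2 := fun ⟨_, hg⟩ => hg.1.cyclicBound hM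
    tfae_have 2 → 1 := fun hf => by
      obtain ⟨H, _, _, _, ⟨D⟩⟩ := hf.exists_idealGNS hM
      exact ⟨_, D.isMinimalRepresentableExtension_vectorFunctional⟩
    tfae_have 2 → 3 := fun hf => by
      obtain ⟨H, _, _, _, ⟨D⟩⟩ := hf.exists_idealGNS hM
      exact D.supBound
    tfae_have 3 → 2 := cyclicBound_of_supBound
    tfae_finish
  · obtain ⟨H, _, _, _, ⟨D⟩⟩ := (cyclicBound_of_supBound hf).exists_idealGNS hM
    have hA := D.isKreinVonNeumannExtension_gramOperator D.continuous_apply_star_mul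
    refine ⟨D.continuous_apply_star_mul, ⟨_, hA⟩, fun AN fN hAN hfN x => ?_⟩
    rw [D.eq_vectorFunctional he hfN, hAN.unique hA, D.vectorFunctional_eq_conj_gramOperator he]
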